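/- Let $1\le r,p,p_1,\dots,p_m\le\infty$ with $\frac1p=\frac1{p_1}+\dots+\frac1{p_m}+\frac1r$ (where $1/\infty=0$), let $E_1,\dots,E_m,F$ be real Banach lattices, and let $T:E_1\times\dots\times E_m\to F$ be a bounded $m$-linear operator. Duals carry their natural order, $E^+$ denotes the positive cone of $E$, and $B^+_{E^*}=\{\varphi\in E^*:\|\varphi\|\le1,\ \varphi\ge0\}$ carries the weak-$*$ topology. For $x_1,\dots,x_n$ in a Banach space $X$ put $\|(x_i)_{i=1}^n\|_{q,w}=\sup_{\varphi\in B_{X^*}}\|(\varphi(x_i))_{i=1}^n\|_{\ell_q^n}$. The operator $T$ is called positive $(p_1,\dots,p_m;r)$-dominated if there is a constant $C>0$ such that $$\Big\|\big(\langle T(x_i^1,\dots,x_i^m),y_i^*\rangle\big)_{i=1}^n\Big\|_{\ell_p^n}\le C\prod_{j=1}^m\|(x_i^j)_{i=1}^n\|_{p_j,w}\ \|(y_i^*)_{i=1}^n\|_{r,w}$$ for all $n$, all $x_1^j,\dots,x_n^j\in E_j^+$ ($1\le j\le m$) and all $y_1^*,\dots,y_n^*\in F^{*+}$. The following statements are equivalent.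 1) $T$ is positive $(p_1,\dots,p_m;r)$-dominated. 2) There are a constant $C>0$ and Borel probability measures $\mu_j$ on $B^+_{E_j^*}$ ($1\le j\le m$) and $\mu_{m+1}$ on $B^+_{F^{**}}$ such that $$|\langle T(x^1,\dots,x^m),y^*\rangle|\le C\prod_{j=1}^m\Big(\int_{B^+_{E_j^*}}\langle|x^j|,\varphi_j\rangle^{p_j}\,d\mu_j\Big)^{1/p_j}\Big(\int_{B^+_{F^{**}}}\langle|y^*|,\varphi_{m+1}\rangle^{r}\,d\mu_{m+1}\Big)^{1/r}$$ for all $(x^1,\dots,x^m,y^*)\in E_1\times\dots\times E_m\times F^*$. 3) There are a constant $C>0$ and Borel probability measures $\mu_j$ on $B^+_{E_j^*}$ ($1\le j\le m$) and $\mu_{m+1}$ on $B^+_{F^{**}}$ such that $$|\langle T(x^1,\dots,x^m),y^*\rangle|\le C\prod_{j=1}^m\Big(\int_{B^+_{E_j^*}}\langle x^j,\varphi_j\rangle^{p_j}\,d\mu_j\Big)^{1/p_j}\Big(\int_{B^+_{F^{**}}}\langle y^*,\varphi_{m+1}\rangle^{r}\,d\mu_{m+1}\Big)^{1/r}$$ for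 all $(x^1,\dots,x^m,y^*)\in E_1^+\times\dots\times E_m^+\times F^{*+}$. Here, when an exponent $p_j$ or $r$ is $\infty$, the corresponding factor $\big(\int_{B^+}\langle z,\varphi\rangle^{\infty}d\mu\big)^{1/\infty}$ means $\sup_{\varphi\in B^+}\langle z,\varphi\rangle$. -/

import Mathlib

open MeasureTheory
open scoped ENNReal

namespace PositiveDominated

noncomputable section

section DualLattice

variable {E : Type*} [NormedAddCommGroup E] [NormedSpace ℝ E] [Lattice E] [HasSolidNorm E]
  [IsOrderedAddMonoid E]

/-- The Riesz-Kantorovich formula `f⁺(x) = sup {f y : 0 ≤ y ≤ x}`, meant for `x ≥ 0`. -/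
def rieszPos (f : StrongDual ℝ E) (x : E) : ℝ := sSup (f '' Set.Icc 0 x)

theorem le_norm_mul_of_mem_Icc (f : StrongDual ℝ E) {x y : E} (hy : y ∈ Set.Icc 0 x) :
    f y ≤ ‖f‖ * ‖x‖ := by
  have h1 : ‖y‖ ≤ ‖x‖ := by
    apply norm_le_norm_of_abs_le_abs
    rw [abs_of_nonneg hy.1, abs_of_nonneg (hy.1.trans hy.2)]
    exact hy.2
  calc f y ≤ ‖f y‖ := Real.le_norm_self _
    _ ≤ ‖f‖ * ‖y‖ := f.le_opNorm y
    _ ≤ ‖f‖ * ‖x‖ := by gcongr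

theorem bddAbove_rieszPos (f : StrongDual ℝ E) (x : E) : BddAbove (f '' Set.Icc 0 x) := by
  refine ⟨‖f‖ * ‖x‖, ?_⟩
  rintro _ ⟨y, hy, rfl⟩
  exact le_norm_mul_of_mem_Icc f hy

theorem le_rieszPos (f : StrongDual ℝ E) {x y : E} (h0 : 0 ≤ y) (h : y ≤ x) :
    f y ≤ rieszPos f x :=
  le_csSup (bddAbove_rieszPos f x) ⟨y, ⟨h0, h⟩, rfl⟩

theorem rieszPos_le (f : StrongDual ℝ E) {x : E} (hx : 0 ≤ x) {c : ℝ}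
    (h : ∀ y, 0 ≤ y → y ≤ x → f y ≤ c) : rieszPos f x ≤ c := by
  refine csSup_le ⟨f 0, 0, ⟨le_rfl, hx⟩, rfl⟩ ?_
  rintro _ ⟨y, hy, rfl⟩
  exact h y hy.1 hy.2

theorem rieszPos_nonneg (f : StrongDual ℝ E) {x : E} (hx : 0 ≤ x) : 0 ≤ rieszPos f x := by
  simpa using le_rieszPos f le_rfl hx

theorem rieszPos_add (f : StrongDual ℝ E) {x y : E} (hx : 0 ≤ x) (hy : 0 ≤ y) :
    rieszPos f (x + y) = rieszPos f x + rieszPos f y := by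
  apply le_antisymm
  · refine rieszPos_le f (add_nonneg hx hy) fun z hz hzxy => ?_
    have e : z = z ⊓ x + (z - z ⊓ x) := by abel
    rw [e, map_add]
    refine add_le_add (le_rieszPos f (le_inf hz hx) inf_le_right) (le_rieszPos f ?_ ?_)
    · exact sub_nonneg.2 inf_le_left
    · rw [sub_le_iff_le_add, ← sub_le_iff_le_add']
      refine le_inf ?_ ?_
      · exact sub_le_self z hy
      · exact sub_le_iff_le_add.2 hzxy
  · rw [← le_sub_iff_add_le]
    refine rieszPos_le f hx fun a ha hax => ?_
    rw [le_sub_comm]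
    refine rieszPos_le f hy fun b hb hby => ?_
    rw [le_sub_iff_add_le', ← map_add]
    exact le_rieszPos f (add_nonneg ha hb) (add_le_add hax hby)

/-- If `x = a - b` with `a, b ≥ 0`, then `f⁺(a) - f⁺(b)` depends only on `x`. -/
theorem rieszPos_sub_eq (f : StrongDual ℝ E) {a b c d : E} (ha : 0 ≤ a) (hb : 0 ≤ b)
    (hc : 0 ≤ c) (hd : 0 ≤ d) (h : a - b = c - d) :
    rieszPos f a - rieszPos f b = rieszPos f c - rieszPos f d := by
  have h1 : a + d = c + b := sub_eq_sub_iff_add_eq_add.1 h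
  have h2 := congrArg (rieszPos f) h1
  rw [rieszPos_add f ha hd, rieszPos_add f hc hb] at h2
  linarith

/-- The additive extension of `rieszPos f` from the positive cone to the whole lattice. -/
def dualPosAddHom (f : StrongDual ℝ E) : E →+ ℝ :=
  AddMonoidHom.mk' (fun x => rieszPos f x⁺ - rieszPos f x⁻) (by
    intro x y
    rw [rieszPos_sub_eq f (posPart_nonneg (x + y)) (negPart_nonneg (x + y))
      (add_nonneg (posPart_nonneg x) (posPart_nonneg y))
      (add_nonneg (negPart_nonneg x) (negPart_nonneg y)),
      rieszPos_add f (posPart_nonneg x) (posPart_nonneg y),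
      rieszPos_add f (negPart_nonneg x) (negPart_nonneg y)]
    · ring
    · rw [posPart_sub_negPart, add_sub_add_comm, posPart_sub_negPart, posPart_sub_negPart])

theorem dualPosAddHom_bound (f : StrongDual ℝ E) (x : E) :
    ‖dualPosAddHom f x‖ ≤ ‖f‖ * ‖x‖ := by
  have hp : ‖x⁺‖ ≤ ‖x‖ := by
    apply norm_le_norm_of_abs_le_abs
    rw [abs_of_nonneg (posPart_nonneg x), ← posPart_add_negPart x]
    exact le_add_of_nonneg_right (negPart_nonneg x)
  have hn : ‖x⁻‖ ≤ ‖x‖ := by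
    apply norm_le_norm_of_abs_le_abs
    rw [abs_of_nonneg (negPart_nonneg x), ← posPart_add_negPart x]
    exact le_add_of_nonneg_left (posPart_nonneg x)
  have key : ∀ z : E, 0 ≤ z → ‖z‖ ≤ ‖x‖ → rieszPos f z ≤ ‖f‖ * ‖x‖ := fun z hz hzx =>
    rieszPos_le f hz fun y hy hyz =>
      (le_norm_mul_of_mem_Icc f ⟨hy, hyz⟩).trans (by gcongr)
  have h1 := key _ (posPart_nonneg x) hp
  have h2 := key _ (negPart_nonneg x) hn
  have h3 := rieszPos_nonneg f (posPart_nonneg x)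
  have h4 := rieszPos_nonneg f (negPart_nonneg x)
  change |rieszPos f x⁺ - rieszPos f x⁻| ≤ _
  rw [abs_le]
  constructor <;> linarith

/-- The positive part `f⁺` of a bounded linear functional `f`. -/
def dualPos (f : StrongDual ℝ E) : StrongDual ℝ E :=
  (dualPosAddHom f).toRealLinearMap
    (AddMonoidHomClass.continuous_of_bound (dualPosAddHom f) ‖f‖ (dualPosAddHom_bound f))

theorem dualPos_apply (f : StrongDual ℝ E) {x : E} (hx : 0 ≤ x) :
    dualPos f x = rieszPos f x := by
  change rieszPos f x⁺ - rieszPos f x⁻ = _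
  rw [rieszPos_sub_eq f (posPart_nonneg x) (negPart_nonneg x) hx le_rfl
    (by rw [posPart_sub_negPart, sub_zero])]
  have : rieszPos f (0 : E) = 0 := by
    have := rieszPos_add f (le_refl (0 : E)) (le_refl (0 : E))
    rw [add_zero] at this
    linarith
  rw [this, sub_zero]

/-- The natural order of the dual, `f ≤ g ↔ ∀ x ≥ 0, f x ≤ g x`. -/
instance instPartialOrderDual : PartialOrder (StrongDual ℝ E) where
  le f g := ∀ x : E, 0 ≤ x → f x ≤ g x
  le_refl _ _ _ := le_rfl
  le_trans _ _ _ h1 h2 x hx := (h1 x hx).trans (h2 x hx)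
  le_antisymm f g h1 h2 := by
    ext x
    rw [← posPart_sub_negPart x, map_sub, map_sub,
      le_antisymm (h1 _ (posPart_nonneg x)) (h2 _ (posPart_nonneg x)),
      le_antisymm (h1 _ (negPart_nonneg x)) (h2 _ (negPart_nonneg x))]

/-- The dual of a normed lattice is a lattice for the natural order. In particular `|f|` is
Mathlib's absolute value `f ⊔ -f` for this order. -/
instance instLatticeDual : Lattice (StrongDual ℝ E) where
  sup f g := g + dualPos (f - g)
  inf f g := f - dualPos (f - g)
  le_sup_left f g x hx := by
    have h := le_rieszPos (f - g) hx le_rfl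
    simp only [add_apply, sub_apply,
      dualPos_apply _ hx] at h ⊢
    linarith
  le_sup_right f g x hx := by
    have h := rieszPos_nonneg (f - g) hx
    simp only [add_apply, dualPos_apply _ hx]
    linarith
  sup_le f g h hf hg x hx := by
    have : rieszPos (f - g) x ≤ h x - g x := rieszPos_le _ hx fun y hy hyx => by
      have h1 := hg (x - y) (sub_nonneg.2 hyx)
      have h2 := hf y hy
      simp only [map_sub, sub_apply] at h1 ⊢
      linarith
    simp only [add_apply, dualPos_apply _ hx]
    linarith
  inf_le_left f g x hx := by
    have h := rieszPos_nonneg (f - g) hx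
    simp only [sub_apply, dualPos_apply _ hx]
    linarith
  inf_le_right f g x hx := by
    have h := le_rieszPos (f - g) hx le_rfl
    simp only [sub_apply, dualPos_apply _ hx] at h ⊢
    linarith
  le_inf h f g hf hg x hx := by
    have : rieszPos (f - g) x ≤ f x - h x := rieszPos_le _ hx fun y hy hyx => by
      have h1 := hf (x - y) (sub_nonneg.2 hyx)
      have h2 := hg y hy
      simp only [map_sub, sub_apply] at h1 ⊢
      linarith
    simp only [sub_apply, dualPos_apply _ hx]
    linarith

end DualLattice

/-- The positive part `B_{E*}⁺` of the closed unit ball of the dual, as a subset of `E*` with the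
weak-* topology; as a subtype it carries the induced weak-* topology. -/
def posDualBall (E : Type*) [NormedAddCommGroup E] [NormedSpace ℝ E] [PartialOrder E] :
    Set (WeakDual ℝ E) :=
  {φ | ‖WeakDual.toStrongDual φ‖ ≤ 1 ∧ ∀ x : E, 0 ≤ x → 0 ≤ φ x}

/-- The Borel σ-algebra of the weak-* topology. -/
instance instMeasurableSpacePosDualBall (E : Type*) [NormedAddCommGroup E] [NormedSpace ℝ E]
    [PartialOrder E] : MeasurableSpace (posDualBall E) := borel _

instance instBorelSpacePosDualBall (E : Type*) [NormedAddCommGroup E] [NormedSpace ℝ E]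
    [PartialOrder E] : BorelSpace (posDualBall E) := ⟨rfl⟩

/-- The `ℓ_p^n` norm of a finite real sequence, `1 ≤ p ≤ ∞`. -/
def seqNorm (p : ℝ≥0∞) {n : ℕ} (a : Fin n → ℝ) : ℝ := ‖WithLp.toLp p a‖

/-- The weak `ℓ_p` norm `‖(x_i)‖_{p,w} = sup_{φ ∈ B_{X*}} ‖(φ(x_i))_i‖_p`. -/
def weakSeqNorm (p : ℝ≥0∞) {X : Type*} [NormedAddCommGroup X] [NormedSpace ℝ X] {n : ℕ}
    (x : Fin n → X) : ℝ :=
  ⨆ φ : Metric.closedBall (0 : StrongDual ℝ X) 1, seqNorm p fun i => φ.1 (x i)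

/-- `(∫_{B_{E*}⁺} ⟨x, φ⟩^p dμ(φ))^{1/p}` for `x ≥ 0`. For `p = ∞` this is, as usual in Pietsch
domination, `sup_{φ ∈ B_{E*}⁺} ⟨x, φ⟩` (not the `μ`-essential supremum). -/
def domFactor (p : ℝ≥0∞) {E : Type*} [NormedAddCommGroup E] [NormedSpace ℝ E] [PartialOrder E]
    (μ : Measure (posDualBall E)) (x : E) : ℝ :=
  if p = ∞ then ⨆ φ : posDualBall E, φ.1 x
  else (∫ φ : posDualBall E, (φ.1 x) ^ p.toReal ∂μ) ^ (1 / p.toReal)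

/-- Positive `(p_1, …, p_m; r)`-dominated multilinear operators; `p` is the exponent with
`1/p = 1/p_1 + ⋯ + 1/p_m + 1/r`. -/
def IsPositiveDominated {m : ℕ} (p : ℝ≥0∞) (q : Fin m → ℝ≥0∞) (r : ℝ≥0∞)
    {E : Fin m → Type*} [∀ j, NormedAddCommGroup (E j)] [∀ j, NormedSpace ℝ (E j)]
    [∀ j, Lattice (E j)]
    {F : Type*} [NormedAddCommGroup F] [NormedSpace ℝ F] [Lattice F] [HasSolidNorm F]
    [IsOrderedAddMonoid F] (T : ContinuousMultilinearMap ℝ E F) : Prop :=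
  ∃ C : ℝ, 0 < C ∧ ∀ (n : ℕ) (x : ∀ j, Fin n → E j) (y : Fin n → StrongDual ℝ F),
    (∀ j i, 0 ≤ x j i) → (∀ i, 0 ≤ y i) →
      seqNorm p (fun i => y i (T fun j => x j i)) ≤
        C * (∏ j, weakSeqNorm (q j) (x j)) * weakSeqNorm r y

end

end PositiveDominated

/-! The core is 1 ⇒ 3, a Pietsch argument by Hahn–Banach separation. Let K be the compact product of
the positive dual balls. After raising the dominated inequality to the power p, weighted AM-GM with
weights p/p_j and p/r (their sum is 1) replaces the product of weak norms by a sum of one-coordinate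
terms, each attained at a point of its ball. Hence every nonnegative combination of the functions
|⟨Tx, y*⟩|^p − C^p (∑ (p/p_j) φ_j(x^j)^{p_j} + (p/r) ψ(y*)^r) on K is nonpositive somewhere, the
weights being absorbed into the vectors by homogeneity (`exists_weighted_sum_nonpos`).

Separation (`exists_positive_functional`) then gives a positive normalised functional on C(K). Each
function is a sum of functions of one coordinate, so only the marginals matter, and Riesz–Markov
represents these by measures (`exists_marginal_measure`). Rescaling each vector by its factor turns
the sum back into a product.

The positive ball suffices for weak norms of positive vectors: passing from a functional to its
modulus keeps the norm and does not decrease absolute values on the cone.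

The implication 3 ⇒ 1 is Hölder's inequality, 3 ⇒ 2 splits every argument into positive and negative
parts, and 2 ⇒ 3 is immediate.

Since `toReal` sends ∞ to 0, coordinates with infinite exponent get weight p/∞ = 0. They drop out of
the sums and are controlled by a normalisation instead. The case p = ∞ forces all exponents to be ∞
and is treated directly. -/

namespace PositiveDominated

/-! ### The dual as a normed lattice. -/

section DualOrder

theorem dual_le_iff {E : Type*} [NormedAddCommGroup E] [NormedSpace ℝ E] [Lattice E]
    [IsOrderedAddMonoid E] {f g : StrongDual ℝ E} :
    f ≤ g ↔ ∀ x : E, 0 ≤ x → f x ≤ g x := Iff.rfl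

theorem dual_nonneg_iff {E : Type*} [NormedAddCommGroup E] [NormedSpace ℝ E] [Lattice E]
    [IsOrderedAddMonoid E] {f : StrongDual ℝ E} :
    0 ≤ f ↔ ∀ x : E, 0 ≤ x → 0 ≤ f x := Iff.rfl

variable {E : Type*} [NormedAddCommGroup E] [NormedSpace ℝ E] [Lattice E] [HasSolidNorm E]
  [IsOrderedAddMonoid E]

instance instIsOrderedAddMonoidDual : IsOrderedAddMonoid (StrongDual ℝ E) where
  add_le_add_left f g h k x hx := by
    have := h x hx
    simp only [add_apply]
    linarith

theorem abs_apply_le (f : StrongDual ℝ E) (x : E) : |f x| ≤ |f| |x| := by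
  have h : ∀ z : E, 0 ≤ z → |f z| ≤ |f| z := fun z hz => by
    have h1 := dual_le_iff.1 (le_abs_self f) z hz
    have h2 := dual_le_iff.1 (neg_le_abs f) z hz
    rw [neg_apply] at h2
    exact abs_le.2 ⟨by linarith, h1⟩
  have e : f x = f x⁺ - f x⁻ := by rw [← map_sub, posPart_sub_negPart]
  rw [← posPart_add_negPart x, map_add, e]
  exact (abs_sub _ _).trans
    (add_le_add (h _ (posPart_nonneg x)) (h _ (negPart_nonneg x)))

/-- Here |f| = −f + (2f)⁺, and for 0 ≤ y ≤ x one has |2y − x| ≤ x, so f(2y) − f(x) ≤ ‖f‖‖x‖. The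
supremum over y gives the sharp constant ‖f‖, which the triangle inequality would not. -/
theorem abs_dual_apply_le (f : StrongDual ℝ E) {x : E} (hx : 0 ≤ x) : |f| x ≤ ‖f‖ * ‖x‖ := by
  have h : rieszPos (f - -f) x ≤ ‖f‖ * ‖x‖ + f x := rieszPos_le _ hx fun y hy hyx => by
    have h1 : ‖y + y - x‖ ≤ ‖x‖ := by
      apply norm_le_norm_of_abs_le_abs
      rw [abs_of_nonneg hx, abs_le']
      constructor
      · rw [sub_le_iff_le_add]
        exact add_le_add hyx hyx
      · rw [neg_sub]
        exact sub_le_self x (add_nonneg hy hy)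
    have h2 : f (y + y - x) ≤ ‖f‖ * ‖x‖ :=
      (Real.le_norm_self _).trans ((f.le_opNorm _).trans (by gcongr))
    simp only [map_sub, map_add, sub_apply, neg_apply] at h2 ⊢
    linarith
  change (-f + dualPos (f - -f)) x ≤ _
  rw [add_apply, neg_apply, dualPos_apply _ hx]
  linarith

/-- Used in two ways: moduli of functionals stay in the unit ball, and F* becomes a normed lattice
to which the lemmas for E_j apply verbatim. -/
instance instHasSolidNormDual : HasSolidNorm (StrongDual ℝ E) where
  solid f g h := by
    refine ContinuousLinearMap.opNorm_le_bound _ (norm_nonneg g) fun x => ?_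
    rw [Real.norm_eq_abs]
    calc |f x| ≤ |f| |x| := abs_apply_le f x
      _ ≤ |g| |x| := dual_le_iff.1 h _ (abs_nonneg x)
      _ ≤ ‖g‖ * ‖|x|‖ := abs_dual_apply_le g (abs_nonneg x)
      _ = ‖g‖ * ‖x‖ := by rw [norm_abs_eq_norm]

/-- The modulus of a functional in the dual unit ball, as an element of the positive part. -/
noncomputable def absPosDualBall (f : StrongDual ℝ E) (hf : ‖f‖ ≤ 1) : posDualBall E :=
  ⟨StrongDual.toWeakDual |f|, by
    refine ⟨?_, dual_nonneg_iff.1 (abs_nonneg f)⟩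
    rw [StrongDual.toStrongDual_toWeakDual, norm_abs_eq_norm]
    exact hf⟩

theorem abs_apply_le_absPosDualBall (f : StrongDual ℝ E) (hf : ‖f‖ ≤ 1) {x : E} (hx : 0 ≤ x) :
    |f x| ≤ (absPosDualBall f hf).1 x := by
  have := abs_apply_le f x
  rwa [abs_of_nonneg hx] at this

end DualOrder

/-! ### The compact space of positive functionals and the domination factors on it. -/

section PosDualBall

variable {E : Type*} [NormedAddCommGroup E] [NormedSpace ℝ E] [PartialOrder E]

theorem posDualBall_apply_nonneg (φ : posDualBall E) {x : E} (hx : 0 ≤ x) : 0 ≤ φ.1 x :=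
  φ.2.2 x hx

theorem abs_posDualBall_apply_le (φ : posDualBall E) (x : E) : |φ.1 x| ≤ ‖x‖ := by
  have := (WeakDual.toStrongDual φ.1).le_of_opNorm_le φ.2.1 x
  rwa [one_mul] at this

instance : Nonempty (posDualBall E) :=
  ⟨0, by rw [map_zero, norm_zero]; exact zero_le_one, fun _ _ => le_rfl⟩

theorem continuous_posDualBall_apply (x : E) : Continuous fun φ : posDualBall E => φ.1 x :=
  (WeakDual.eval_continuous x).comp continuous_subtype_val

instance : CompactSpace (posDualBall E) := by
  rw [← isCompact_iff_compactSpace]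
  have h : posDualBall E = WeakDual.toStrongDual ⁻¹' Metric.closedBall (0 : StrongDual ℝ E) 1 ∩
      ⋂ x : E, ⋂ _ : 0 ≤ x, {φ : WeakDual ℝ E | 0 ≤ φ x} := by
    ext φ
    simp [posDualBall]
  rw [h]
  refine (WeakDual.isCompact_closedBall (𝕜 := ℝ) (0 : StrongDual ℝ E) 1).inter_right ?_
  exact isClosed_iInter fun x => isClosed_iInter fun _ =>
    isClosed_le continuous_const (WeakDual.eval_continuous x)

theorem bddAbove_range_posDualBall (x : E) : BddAbove (Set.range fun φ : posDualBall E => φ.1 x) :=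
  ⟨‖x‖, by rintro _ ⟨φ, rfl⟩; exact (le_abs_self _).trans (abs_posDualBall_apply_le φ x)⟩

theorem continuous_posDualBall_rpow (x : E) {s : ℝ} (hs : 0 ≤ s) :
    Continuous fun φ : posDualBall E => (φ.1 x) ^ s :=
  (continuous_posDualBall_apply x).rpow_const fun _ => Or.inr hs

theorem integrable_posDualBall_rpow (μ : Measure (posDualBall E)) [IsFiniteMeasure μ] (x : E)
    {s : ℝ} (hs : 0 ≤ s) : Integrable (fun φ : posDualBall E => (φ.1 x) ^ s) μ :=
  (continuous_posDualBall_rpow x hs).integrable_of_hasCompactSupport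
    (HasCompactSupport.of_compactSpace _)

theorem domFactor_nonneg (p : ℝ≥0∞) (μ : Measure (posDualBall E)) {x : E} (hx : 0 ≤ x) :
    0 ≤ domFactor p μ x := by
  unfold domFactor
  split_ifs
  · exact Real.iSup_nonneg fun φ => posDualBall_apply_nonneg φ hx
  · exact Real.rpow_nonneg (integral_nonneg fun φ =>
      Real.rpow_nonneg (posDualBall_apply_nonneg φ hx) _) _

theorem domFactor_mono (p : ℝ≥0∞) (μ : Measure (posDualBall E)) [IsFiniteMeasure μ]
    [IsOrderedAddMonoid E] {x y : E} (hx : 0 ≤ x) (hxy : x ≤ y) :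
    domFactor p μ x ≤ domFactor p μ y := by
  have h : ∀ φ : posDualBall E, φ.1 x ≤ φ.1 y := fun φ => by
    have := posDualBall_apply_nonneg φ (sub_nonneg.2 hxy)
    rw [map_sub] at this
    linarith
  unfold domFactor
  split_ifs
  · exact ciSup_mono (bddAbove_range_posDualBall y) h
  · refine Real.rpow_le_rpow (integral_nonneg fun φ =>
      Real.rpow_nonneg (posDualBall_apply_nonneg φ hx) _) ?_ (by positivity)
    refine integral_mono (integrable_posDualBall_rpow μ x ENNReal.toReal_nonneg)
      (integrable_posDualBall_rpow μ y ENNReal.toReal_nonneg) fun φ => ?_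
    exact Real.rpow_le_rpow (posDualBall_apply_nonneg φ hx) (h φ) ENNReal.toReal_nonneg

theorem domFactor_top (μ : Measure (posDualBall E)) (x : E) :
    domFactor ∞ μ x = ⨆ φ : posDualBall E, φ.1 x := if_pos rfl

theorem domFactor_smul (p : ℝ≥0∞) (μ : Measure (posDualBall E)) {c : ℝ} (hc : 0 ≤ c) {x : E}
    (hp : 1 ≤ p) (hx : 0 ≤ x) : domFactor p μ (c • x) = c * domFactor p μ x := by
  by_cases hp' : p = ∞
  · subst hp'
    simp only [domFactor_top, map_smul, smul_eq_mul]
    rw [Real.mul_iSup_of_nonneg hc]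
  · have h0 : p.toReal ≠ 0 := (ENNReal.toReal_pos (zero_lt_one.trans_le hp).ne' hp').ne'
    simp only [domFactor, if_neg hp', map_smul, smul_eq_mul]
    simp_rw [Real.mul_rpow hc (posDualBall_apply_nonneg _ hx)]
    rw [integral_const_mul, Real.mul_rpow (by positivity) (integral_nonneg fun φ =>
      Real.rpow_nonneg (posDualBall_apply_nonneg φ hx) _), one_div, Real.rpow_rpow_inv hc h0]

theorem domFactor_rpow {p : ℝ≥0∞} (hp : 1 ≤ p) (hp' : p ≠ ∞) (μ : Measure (posDualBall E)) {x : E}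
    (hx : 0 ≤ x) : domFactor p μ x ^ p.toReal = ∫ φ : posDualBall E, (φ.1 x) ^ p.toReal ∂μ := by
  have h0 : p.toReal ≠ 0 := (ENNReal.toReal_pos (zero_lt_one.trans_le hp).ne' hp').ne'
  rw [domFactor, if_neg hp', one_div, Real.rpow_inv_rpow _ h0]
  exact integral_nonneg fun φ => Real.rpow_nonneg (posDualBall_apply_nonneg φ hx) _

end PosDualBall

/-! ### Strong and weak sequence norms, compared with domination factors. -/

section SeqNorm

theorem seqNorm_top {n : ℕ} (a : Fin n → ℝ) : seqNorm ∞ a = ⨆ i, |a i| :=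
  PiLp.norm_eq_ciSup _

theorem seqNorm_eq_sum {p : ℝ≥0∞} (hp : 1 ≤ p) (hp' : p ≠ ∞) {n : ℕ} (a : Fin n → ℝ) :
    seqNorm p a = (∑ i, |a i| ^ p.toReal) ^ (1 / p.toReal) :=
  PiLp.norm_eq_sum (ENNReal.toReal_pos (zero_lt_one.trans_le hp).ne' hp') _

theorem seqNorm_rpow {p : ℝ≥0∞} (hp : 1 ≤ p) (hp' : p ≠ ∞) {n : ℕ} (a : Fin n → ℝ) :
    seqNorm p a ^ p.toReal = ∑ i, |a i| ^ p.toReal := by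
  have h0 : p.toReal ≠ 0 := (ENNReal.toReal_pos (zero_lt_one.trans_le hp).ne' hp').ne'
  rw [seqNorm_eq_sum hp hp', one_div, Real.rpow_inv_rpow _ h0]
  positivity

theorem seqNorm_nonneg {p : ℝ≥0∞} (hp : 1 ≤ p) {n : ℕ} (a : Fin n → ℝ) : 0 ≤ seqNorm p a := by
  have : Fact (1 ≤ p) := ⟨hp⟩
  exact norm_nonneg _

theorem seqNorm_mono {p : ℝ≥0∞} (hp : 1 ≤ p) {n : ℕ} {a b : Fin n → ℝ} (h : ∀ i, |a i| ≤ |b i|) :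
    seqNorm p a ≤ seqNorm p b := by
  by_cases hp' : p = ∞
  · subst hp'
    rw [seqNorm_top, seqNorm_top]
    exact ciSup_mono (Set.finite_range _).bddAbove h
  · rw [seqNorm_eq_sum hp hp', seqNorm_eq_sum hp hp']
    exact Real.rpow_le_rpow (by positivity) (Finset.sum_le_sum fun i _ =>
      Real.rpow_le_rpow (abs_nonneg _) (h i) ENNReal.toReal_nonneg) (by positivity)

theorem bddAbove_weakSeqNorm {p : ℝ≥0∞} (hp : 1 ≤ p) {X : Type*} [NormedAddCommGroup X]
    [NormedSpace ℝ X] {n : ℕ} (x : Fin n → X) :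
    BddAbove (Set.range fun φ : Metric.closedBall (0 : StrongDual ℝ X) 1 =>
      seqNorm p fun i => φ.1 (x i)) := by
  refine ⟨seqNorm p fun i => ‖x i‖, ?_⟩
  rintro _ ⟨φ, rfl⟩
  refine seqNorm_mono hp fun i => ?_
  rw [abs_norm]
  have h := φ.1.le_of_opNorm_le (mem_closedBall_zero_iff.1 φ.2) (x i)
  rwa [one_mul] at h

theorem weakSeqNorm_nonneg {p : ℝ≥0∞} (hp : 1 ≤ p) {X : Type*} [NormedAddCommGroup X]
    [NormedSpace ℝ X] {n : ℕ} (x : Fin n → X) : 0 ≤ weakSeqNorm p x :=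
  Real.iSup_nonneg fun _ => seqNorm_nonneg hp _

theorem seqNorm_posDualBall_le {p : ℝ≥0∞} (hp : 1 ≤ p) {E : Type*} [NormedAddCommGroup E]
    [NormedSpace ℝ E] [PartialOrder E] {n : ℕ} (x : Fin n → E) (φ : posDualBall E) :
    (seqNorm p fun i => φ.1 (x i)) ≤ weakSeqNorm p x :=
  le_ciSup (bddAbove_weakSeqNorm hp x)
    ⟨WeakDual.toStrongDual φ.1, mem_closedBall_zero_iff.2 φ.2.1⟩

/-- The bound holds pointwise at every φ in the positive ball; integrating against a probability
measure keeps it. -/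
theorem sum_domFactor_rpow_le {p : ℝ≥0∞} (hp : 1 ≤ p) (hp' : p ≠ ∞) {E : Type*}
    [NormedAddCommGroup E] [NormedSpace ℝ E] [PartialOrder E] (μ : Measure (posDualBall E))
    [IsProbabilityMeasure μ] {n : ℕ} {x : Fin n → E} (hx : ∀ i, 0 ≤ x i) :
    ∑ i, domFactor p μ (x i) ^ p.toReal ≤ weakSeqNorm p x ^ p.toReal := by
  simp_rw [domFactor_rpow hp hp' μ (hx _)]
  rw [← integral_finsetSum _ fun i _ => integrable_posDualBall_rpow μ (x i) ENNReal.toReal_nonneg]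
  refine (integral_mono (integrable_finsetSum _ fun i _ => integrable_posDualBall_rpow μ (x i)
    ENNReal.toReal_nonneg) (integrable_const (weakSeqNorm p x ^ p.toReal)) fun φ => ?_).trans
    (by simp)
  have h := Real.rpow_le_rpow (seqNorm_nonneg hp _) (seqNorm_posDualBall_le hp x φ)
    (ENNReal.toReal_nonneg (a := p))
  rw [seqNorm_rpow hp hp'] at h
  simpa only [abs_of_nonneg (posDualBall_apply_nonneg φ (hx _))] using h

theorem domFactor_top_le_weakSeqNorm {E : Type*} [NormedAddCommGroup E] [NormedSpace ℝ E]
    [PartialOrder E] (μ : Measure (posDualBall E)) {n : ℕ} (x : Fin n → E) (i : Fin n) :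
    domFactor ∞ μ (x i) ≤ weakSeqNorm ∞ x := by
  rw [domFactor_top]
  refine ciSup_le fun φ => (le_abs_self _).trans ?_
  refine le_trans ?_ (seqNorm_posDualBall_le le_top x φ)
  rw [seqNorm_top]
  exact le_ciSup (f := fun i => |φ.1 (x i)|) (Set.finite_range _).bddAbove i

variable {E : Type*} [NormedAddCommGroup E] [NormedSpace ℝ E] [Lattice E] [HasSolidNorm E]
  [IsOrderedAddMonoid E] {n : ℕ} {x : Fin n → E}

/-- For positive vectors, φ may be replaced by |φ|, so only positive functionals need testing. -/
theorem weakSeqNorm_le {p : ℝ≥0∞} (hp : 1 ≤ p) (hx : ∀ i, 0 ≤ x i) {c : ℝ}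
    (h : ∀ φ : posDualBall E, (seqNorm p fun i => φ.1 (x i)) ≤ c) : weakSeqNorm p x ≤ c := by
  have : Nonempty (Metric.closedBall (0 : StrongDual ℝ E) 1) :=
    ⟨0, Metric.mem_closedBall_self zero_le_one⟩
  refine ciSup_le fun φ => ?_
  have hφ : ‖φ.1‖ ≤ 1 := mem_closedBall_zero_iff.1 φ.2
  refine le_trans (seqNorm_mono hp fun i => ?_) (h (absPosDualBall φ.1 hφ))
  exact (abs_apply_le_absPosDualBall φ.1 hφ (hx i)).trans (le_abs_self _)

theorem weakSeqNorm_top_le (hx : ∀ i, 0 ≤ x i) (μ : Measure (posDualBall E)) {c : ℝ} (hc : 0 ≤ c)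
    (h : ∀ i, domFactor ∞ μ (x i) ≤ c) : weakSeqNorm ∞ x ≤ c := by
  refine weakSeqNorm_le le_top hx fun φ => ?_
  rw [seqNorm_top]
  refine Real.iSup_le (fun i => ?_) hc
  rw [abs_of_nonneg (posDualBall_apply_nonneg φ (hx i))]
  refine le_trans ?_ (h i)
  rw [domFactor_top]
  exact le_ciSup (bddAbove_range_posDualBall (x i)) φ

/-- The sum is weak-* continuous in φ, so it attains its maximum on the compact positive ball. -/
theorem exists_weakSeqNorm_rpow_le {p : ℝ≥0∞} (hp : 1 ≤ p) (hp' : p ≠ ∞) (hx : ∀ i, 0 ≤ x i) :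
    ∃ φ : posDualBall E, weakSeqNorm p x ^ p.toReal ≤ ∑ i, (φ.1 (x i)) ^ p.toReal := by
  have h0 : p.toReal ≠ 0 := (ENNReal.toReal_pos (zero_lt_one.trans_le hp).ne' hp').ne'
  obtain ⟨φ, -, hφ⟩ := isCompact_univ.exists_isMaxOn Set.univ_nonempty
    (continuous_finsetSum Finset.univ fun i _ =>
      continuous_posDualBall_rpow (x i) (ENNReal.toReal_nonneg (a := p))).continuousOn
  have hpos : 0 ≤ ∑ i, (φ.1 (x i)) ^ p.toReal :=
    Finset.sum_nonneg fun i _ => Real.rpow_nonneg (posDualBall_apply_nonneg φ (hx i)) _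
  refine ⟨φ, ?_⟩
  have h : weakSeqNorm p x ≤ (∑ i, (φ.1 (x i)) ^ p.toReal) ^ (1 / p.toReal) := by
    refine weakSeqNorm_le hp hx fun ψ => ?_
    rw [seqNorm_eq_sum hp hp']
    simp_rw [abs_of_nonneg (posDualBall_apply_nonneg ψ (hx _))]
    exact Real.rpow_le_rpow (Finset.sum_nonneg fun i _ =>
      Real.rpow_nonneg (posDualBall_apply_nonneg ψ (hx i)) _) (hφ (Set.mem_univ ψ)) (by positivity)
  calc weakSeqNorm p x ^ p.toReal
      ≤ ((∑ i, (φ.1 (x i)) ^ p.toReal) ^ (1 / p.toReal)) ^ p.toReal :=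
        Real.rpow_le_rpow (weakSeqNorm_nonneg hp x) h ENNReal.toReal_nonneg
    _ = _ := by rw [one_div, Real.rpow_inv_rpow hpos h0]

end SeqNorm

/-! ### Weighted AM-GM and Hölder's inequality for mixed finite and infinite exponents. -/

section Hoelder

variable {ι : Type*} [Fintype ι] {p : ℝ≥0∞} {Q : ι → ℝ≥0∞}

/-- For an infinite exponent, `toReal` is 0 and 0⁻¹ = 0, in agreement with 1/∞ = 0; no case
distinction is needed. -/
theorem toReal_inv_eq_sum (hQ : ∀ k, 1 ≤ Q k) (hpQ : p⁻¹ = ∑ k, (Q k)⁻¹) :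
    p.toReal⁻¹ = ∑ k, (Q k).toReal⁻¹ := by
  have h := congrArg ENNReal.toReal hpQ
  rw [ENNReal.toReal_sum fun k _ => ENNReal.inv_ne_top.2 (zero_lt_one.trans_le (hQ k)).ne'] at h
  simpa only [ENNReal.toReal_inv] using h

theorem sum_toReal_div (hp : 1 ≤ p) (hp' : p ≠ ∞) (hQ : ∀ k, 1 ≤ Q k)
    (hpQ : p⁻¹ = ∑ k, (Q k)⁻¹) : ∑ k, p.toReal / (Q k).toReal = 1 := by
  have h0 : p.toReal ≠ 0 := (ENNReal.toReal_pos (zero_lt_one.trans_le hp).ne' hp').ne'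
  simp_rw [div_eq_mul_inv]
  rw [← Finset.mul_sum, ← toReal_inv_eq_sum hQ hpQ, mul_inv_cancel₀ h0]

/-- This is weighted AM-GM applied to the numbers b_k^{Q_k}. A factor with infinite exponent has
weight 0, so it must be bounded by 1 separately. -/
theorem prod_rpow_le_sum (hp : 1 ≤ p) (hp' : p ≠ ∞) (hQ : ∀ k, 1 ≤ Q k)
    (hpQ : p⁻¹ = ∑ k, (Q k)⁻¹) {b : ι → ℝ} (hb : ∀ k, 0 ≤ b k) (hb1 : ∀ k, Q k = ∞ → b k ≤ 1) :
    (∏ k, b k) ^ p.toReal ≤ ∑ k, p.toReal / (Q k).toReal * b k ^ (Q k).toReal := by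
  rw [← Real.finsetProd_rpow _ _ fun k _ => hb k]
  refine le_trans (Finset.prod_le_prod (fun k _ => Real.rpow_nonneg (hb k) _) fun k _ => ?_)
    (Real.geom_mean_le_arith_mean_weighted Finset.univ (fun k => p.toReal / (Q k).toReal)
      (fun k => b k ^ (Q k).toReal) (fun k _ => by positivity) (sum_toReal_div hp hp' hQ hpQ)
      fun k _ => Real.rpow_nonneg (hb k) _)
  by_cases h : Q k = ∞
  · simpa [h] using Real.rpow_le_one (hb k) (hb1 k h) ENNReal.toReal_nonneg
  · have h0 : (Q k).toReal ≠ 0 := (ENNReal.toReal_pos (zero_lt_one.trans_le (hQ k)).ne' h).ne'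
    rw [← Real.rpow_mul (hb k), mul_div_cancel₀ _ h0]

/-- The generalised Hölder inequality for finite sums. -/
theorem sum_prod_rpow_le (hp : 1 ≤ p) (hp' : p ≠ ∞) (hQ : ∀ k, 1 ≤ Q k)
    (hpQ : p⁻¹ = ∑ k, (Q k)⁻¹) {n : ℕ} {d : ι → Fin n → ℝ} (hd : ∀ k i, 0 ≤ d k i) {W : ι → ℝ}
    (hW : ∀ k, 0 < W k) (h : ∀ k, Q k ≠ ∞ → ∑ i, d k i ^ (Q k).toReal ≤ W k ^ (Q k).toReal)
    (h' : ∀ k, Q k = ∞ → ∀ i, d k i ≤ W k) :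
    ∑ i, (∏ k, d k i) ^ p.toReal ≤ (∏ k, W k) ^ p.toReal := by
  have hW' : 0 < ∏ k, W k := Finset.prod_pos fun k _ => hW k
  -- After division by W the claim is homogeneous of size 1, and termwise AM-GM suffices.
  have key : ∑ i, (∏ k, d k i / W k) ^ p.toReal ≤ 1 := by
    calc ∑ i, (∏ k, d k i / W k) ^ p.toReal
        ≤ ∑ i, ∑ k, p.toReal / (Q k).toReal * (d k i / W k) ^ (Q k).toReal :=
          Finset.sum_le_sum fun i _ => prod_rpow_le_sum hp hp' hQ hpQ
            (fun k => div_nonneg (hd k i) (hW k).le)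
            fun k hk => (div_le_one (hW k)).2 (h' k hk i)
      _ = ∑ k, p.toReal / (Q k).toReal * ∑ i, (d k i / W k) ^ (Q k).toReal := by
          rw [Finset.sum_comm]
          simp_rw [Finset.mul_sum]
      _ ≤ ∑ k, p.toReal / (Q k).toReal := by
          refine Finset.sum_le_sum fun k _ => ?_
          by_cases hk : Q k = ∞
          · simp [hk]
          · refine mul_le_of_le_one_right (by positivity) ?_
            simp_rw [Real.div_rpow (hd k _) (hW k).le]
            rw [← Finset.sum_div]
            exact (div_le_one (Real.rpow_pos_of_pos (hW k) _)).2 (h k hk)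
      _ = 1 := sum_toReal_div hp hp' hQ hpQ
  simp_rw [Finset.prod_div_distrib,
    Real.div_rpow (Finset.prod_nonneg fun k _ => hd k _) hW'.le] at key
  rwa [← Finset.sum_div, div_le_one (Real.rpow_pos_of_pos hW' _)] at key

theorem prod_rpow_inv_rpow (hp : 1 ≤ p) (hp' : p ≠ ∞) (hQ : ∀ k, 1 ≤ Q k)
    (hpQ : p⁻¹ = ∑ k, (Q k)⁻¹) {c : ℝ} (hc : 0 ≤ c) :
    (∏ k, c ^ (Q k).toReal⁻¹) ^ p.toReal = c := by
  have h0 : p.toReal ≠ 0 := (ENNReal.toReal_pos (zero_lt_one.trans_le hp).ne' hp').ne'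
  rw [← Real.rpow_sum_of_nonneg hc fun k _ => by positivity, ← toReal_inv_eq_sum hQ hpQ,
    Real.rpow_inv_rpow hc h0]

/-- Allows factors to be enlarged by ε, so that one can divide by factors that may vanish. -/
theorem le_mul_prod_of_forall_pos {t C : ℝ} {a : ι → ℝ}
    (h : ∀ ε : ℝ, 0 < ε → t ≤ C * ∏ k, (a k + ε)) : t ≤ C * ∏ k, a k := by
  have hc : Continuous fun ε : ℝ => C * ∏ k, (a k + ε) := by fun_prop
  have ht := (hc.tendsto 0).mono_left (nhdsWithin_le_nhds (s := Set.Ioi 0))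
  simp only [add_zero] at ht
  exact ge_of_tendsto ht (Filter.eventually_of_mem self_mem_nhdsWithin h)

end Hoelder

/-! ### Hahn–Banach separation in C(K) and Riesz–Markov representation of marginals. -/

section Separation

variable {K : Type*} [TopologicalSpace K]

/-- If every nonnegative combination of the functions `f x` is nonpositive somewhere, then all
`f x` are nonpositive under a common positive normalised functional. -/
theorem exists_positive_functional [CompactSpace K] [Nonempty K] {X : Type*} [Nonempty X]
    (f : X → C(K, ℝ))
    (h : ∀ (n : ℕ) (w : Fin n → ℝ) (z : Fin n → X), (∀ i, 0 ≤ w i) →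
      ∃ ω, ∑ i, w i * f (z i) ω ≤ 0) :
    ∃ Λ : C(K, ℝ) →ₗ[ℝ] ℝ, (∀ g, 0 ≤ g → 0 ≤ Λ g) ∧ Λ 1 = 1 ∧ ∀ x, Λ (f x) ≤ 0 := by
  let A : Set C(K, ℝ) := {g | ∀ ω, 0 < g ω}
  have hA : IsOpen A := by
    have := ContinuousMap.isOpen_setOfPred_mapsTo (X := K) (Y := ℝ) isCompact_univ
      (isOpen_Ioi (a := 0))
    simpa [A, Set.MapsTo] using this
  have hAc : Convex ℝ A := by
    intro a ha b hb s t hs ht hst ω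
    have h1 := ha ω
    have h2 := hb ω
    simp only [ContinuousMap.add_apply, ContinuousMap.smul_apply, smul_eq_mul]
    rcases hs.eq_or_lt with rfl | hs
    · rw [zero_add] at hst
      simpa [hst] using h2
    · exact add_pos_of_pos_of_nonneg (mul_pos hs h1) (mul_nonneg ht h2.le)
  have hd : Disjoint A (convexHull ℝ (Set.range f)) := by
    rw [Set.disjoint_left]
    intro g hg hg'
    obtain ⟨ι, _, w, z, hw, -, hz, rfl⟩ := mem_convexHull_iff_exists_fintype.1 hg'
    choose y hy using hz
    let e := Fintype.equivFin ι
    obtain ⟨ω, hω⟩ := h _ (fun i => w (e.symm i)) (fun i => y (e.symm i)) fun i => hw _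
    have h1 := hg ω
    rw [ContinuousMap.sum_apply] at h1
    rw [Equiv.sum_comp e.symm fun i => w i * f (y i) ω] at hω
    simp only [ContinuousMap.smul_apply, smul_eq_mul, ← hy] at h1
    exact h1.not_ge hω
  -- Here φ < u on the open cone A and u ≤ φ on the convex hull. Scaling in the cone forces φ ≤ 0 ≤
  -- u on A, so the required functional is φ divided by the negative number φ(1).
  obtain ⟨φ, u, hφA, hφB⟩ := geometric_hahn_banach_open hAc hA (convex_convexHull ℝ _) hd
  have hsmul : ∀ g ∈ A, ∀ t : ℝ, 0 < t → t * φ g < u := fun g hg t ht => by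
    have := hφA (t • g) fun ω => mul_pos ht (hg ω)
    rwa [map_smul, smul_eq_mul] at this
  have hu : 0 ≤ u := by
    have ht : Filter.Tendsto (fun t : ℝ => t * φ 1) (nhdsWithin 0 (Set.Ioi 0)) (nhds (0 * φ 1)) :=
      ((continuous_id.mul continuous_const).tendsto 0).mono_left nhdsWithin_le_nhds
    rw [zero_mul] at ht
    exact le_of_tendsto ht (Filter.eventually_of_mem self_mem_nhdsWithin fun t ht =>
      (hsmul 1 (fun ω => zero_lt_one) t ht).le)
  have hneg : ∀ g ∈ A, φ g ≤ 0 := fun g hg => by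
    by_contra! hpos
    have := hsmul g hg ((u + 1) / φ g) (by positivity)
    rw [div_mul_cancel₀ _ hpos.ne'] at this
    linarith
  have hnonneg : ∀ g : C(K, ℝ), 0 ≤ g → φ g ≤ 0 := fun g hg => by
    have ht : Filter.Tendsto (fun t : ℝ => φ g + t * φ 1) (nhdsWithin 0 (Set.Ioi 0))
        (nhds (φ g + 0 * φ 1)) :=
      ((continuous_const.add (continuous_id.mul continuous_const)).tendsto 0).mono_left
        nhdsWithin_le_nhds
    rw [zero_mul, add_zero] at ht
    refine le_of_tendsto ht (Filter.eventually_of_mem self_mem_nhdsWithin fun t ht => ?_)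
    have := hneg (g + t • 1) fun ω => add_pos_of_nonneg_of_pos (hg ω) (by simpa using ht)
    rwa [map_add, map_smul, smul_eq_mul] at this
  have h1 : φ 1 < 0 := by
    refine lt_of_le_of_ne (hneg 1 fun ω => zero_lt_one) fun h0 => ?_
    obtain ⟨x⟩ := ‹Nonempty X›
    have h2 := hφB _ (subset_convexHull ℝ _ ⟨x, rfl⟩)
    have h3 := hφA 1 fun ω => zero_lt_one
    -- If φ(1) = 0, this gives φ(f x) ≤ 0, whereas φ(f x) ≥ u > φ(1) = 0.
    have h4 := hnonneg (‖f x‖ • 1 + f x) fun ω => by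
      have := (neg_le_abs _).trans ((f x).norm_coe_le_norm ω)
      change 0 ≤ ‖f x‖ * 1 + f x ω
      linarith
    rw [map_add, map_smul, h0, smul_zero] at h4
    linarith
  refine ⟨(φ 1)⁻¹ • (φ : C(K, ℝ) →ₗ[ℝ] ℝ), fun g hg => ?_, ?_, fun x => ?_⟩
  · exact mul_nonneg_of_nonpos_of_nonpos (inv_nonpos.2 h1.le) (hnonneg g hg)
  · exact inv_mul_cancel₀ h1.ne
  · exact mul_nonpos_of_nonpos_of_nonneg (inv_nonpos.2 h1.le)
      (hu.trans (hφB _ (subset_convexHull ℝ _ ⟨x, rfl⟩)))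

/-- A positive normalised functional on `C(K)` has a marginal along every continuous map. -/
theorem exists_marginal_measure (Λ : C(K, ℝ) →ₗ[ℝ] ℝ) (hΛ : ∀ g, 0 ≤ g → 0 ≤ Λ g) (h1 : Λ 1 = 1)
    {Y : Type*} [TopologicalSpace Y] [CompactSpace Y] [T2Space Y] [MeasurableSpace Y]
    [BorelSpace Y] (π : C(K, Y)) :
    ∃ μ : Measure Y, IsProbabilityMeasure μ ∧ ∀ g : C(Y, ℝ), ∫ y, g y ∂μ = Λ (g.comp π) := by
  let Λ' : CompactlySupportedContinuousMap Y ℝ →ₚ[ℝ] ℝ :=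
    { toFun := fun g => Λ ((g : C(Y, ℝ)).comp π)
      map_add' := fun a b => Λ.map_add ((a : C(Y, ℝ)).comp π) ((b : C(Y, ℝ)).comp π)
      map_smul' := fun c a => Λ.map_smul c ((a : C(Y, ℝ)).comp π)
      monotone' := fun a b hab => by
        have := hΛ ((b : C(Y, ℝ)).comp π - (a : C(Y, ℝ)).comp π) fun ω =>
          sub_nonneg.2 (hab (π ω))
        rw [map_sub] at this
        exact sub_nonneg.1 this }
  have hint : ∀ g : C(Y, ℝ), ∫ y, g y ∂(RealRMK.rieszMeasure Λ') = Λ (g.comp π) := fun g =>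
    RealRMK.integral_rieszMeasure Λ' (CompactlySupportedContinuousMap.continuousMapEquiv g)
  refine ⟨RealRMK.rieszMeasure Λ', ⟨?_⟩, hint⟩
  have h2 := hint 1
  have h3 : (1 : C(Y, ℝ)).comp π = 1 := rfl
  rw [h3, h1] at h2
  simp only [ContinuousMap.one_apply, integral_const, smul_eq_mul, mul_one] at h2
  rwa [Measure.real, ENNReal.toReal_eq_one_iff] at h2

end Separation

/-! ### From the integral inequality on the cones to the whole spaces and to domination. -/

section Dominated

variable {m : ℕ} {p : ℝ≥0∞} {q : Fin m → ℝ≥0∞} {r : ℝ≥0∞}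
  {E : Fin m → Type*} [∀ j, NormedAddCommGroup (E j)] [∀ j, NormedSpace ℝ (E j)]
  [∀ j, Lattice (E j)]
  {F : Type*} [NormedAddCommGroup F] [NormedSpace ℝ F] [Lattice F] [HasSolidNorm F]
  [IsOrderedAddMonoid F]

/-- The product of the domination factors of an `m`-tuple and a functional. -/
noncomputable def domProd (q : Fin m → ℝ≥0∞) (r : ℝ≥0∞) (μ : ∀ j, Measure (posDualBall (E j)))
    (ν : Measure (posDualBall (StrongDual ℝ F))) (x : ∀ j, E j) (y : StrongDual ℝ F) : ℝ :=
  (∏ j, domFactor (q j) (μ j) (x j)) * domFactor r ν y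

theorem domProd_nonneg (μ : ∀ j, Measure (posDualBall (E j)))
    (ν : Measure (posDualBall (StrongDual ℝ F))) {x : ∀ j, E j} {y : StrongDual ℝ F}
    (hx : ∀ j, 0 ≤ x j) (hy : 0 ≤ y) : 0 ≤ domProd q r μ ν x y :=
  mul_nonneg (Finset.prod_nonneg fun j _ => domFactor_nonneg _ _ (hx j)) (domFactor_nonneg _ _ hy)

theorem abs_apply_le_of_forall_nonneg [∀ j, HasSolidNorm (E j)] [∀ j, IsOrderedAddMonoid (E j)]
    (T : ContinuousMultilinearMap ℝ E F) {C : ℝ} (hC : 0 < C)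
    (μ : ∀ j, Measure (posDualBall (E j))) (ν : Measure (posDualBall (StrongDual ℝ F)))
    [∀ j, IsFiniteMeasure (μ j)] [IsFiniteMeasure ν]
    (h : ∀ (x : ∀ j, E j) (y : StrongDual ℝ F), (∀ j, 0 ≤ x j) → 0 ≤ y →
      |y (T x)| ≤ C * domProd q r μ ν x y) (x : ∀ j, E j) (y : StrongDual ℝ F) :
    |y (T x)| ≤ 2 ^ (m + 1) * C * domProd q r μ ν (fun j => |x j|) |y| := by
  have hmono : ∀ (x' : ∀ j, E j) (y' : StrongDual ℝ F), (∀ j, 0 ≤ x' j) → 0 ≤ y' →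
      (∀ j, x' j ≤ |x j|) → y' ≤ |y| →
      |y' (T x')| ≤ C * domProd q r μ ν (fun j => |x j|) |y| := fun x' y' hx hy hx' hy' => by
    refine (h x' y' hx hy).trans (mul_le_mul_of_nonneg_left ?_ hC.le)
    exact mul_le_mul
      (Finset.prod_le_prod (fun j _ => domFactor_nonneg _ _ (hx j))
        fun j _ => domFactor_mono _ _ (hx j) (hx' j))
      (domFactor_mono _ _ hy hy') (domFactor_nonneg _ _ hy)
      (Finset.prod_nonneg fun j _ => domFactor_nonneg _ _ (abs_nonneg _))
  have hpos : ∀ j, (x j)⁺ ≤ |x j| ∧ (x j)⁻ ≤ |x j| := fun j => by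
    rw [← posPart_add_negPart (x j)]
    exact ⟨le_add_of_nonneg_right (negPart_nonneg _), le_add_of_nonneg_left (posPart_nonneg _)⟩
  have hposF : y⁺ ≤ |y| ∧ y⁻ ≤ |y| := by
    rw [← posPart_add_negPart y]
    exact ⟨le_add_of_nonneg_right (negPart_nonneg y), le_add_of_nonneg_left (posPart_nonneg y)⟩
  set D := C * domProd q r μ ν (fun j => |x j|) |y| with hD
  -- Splitting y costs a factor 2; expanding T over the parts of x gives 2^m terms, hence the
  -- constant 2^(m + 1).
  have hy : ∀ x' : ∀ j, E j, (∀ j, 0 ≤ x' j) → (∀ j, x' j ≤ |x j|) → |y (T x')| ≤ 2 * D :=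
    fun x' hx hx' => by
      have e : y (T x') = y⁺ (T x') - y⁻ (T x') := by
        rw [← sub_apply, posPart_sub_negPart]
      rw [e, two_mul]
      exact (abs_sub _ _).trans (add_le_add
        (hmono x' y⁺ hx (posPart_nonneg y) hx' hposF.1)
        (hmono x' y⁻ hx (negPart_nonneg y) hx' hposF.2))
  have hx : x = (fun j => (x j)⁺) + fun j => -(x j)⁻ := by
    ext j
    rw [Pi.add_apply, ← sub_eq_add_neg, posPart_sub_negPart]
  have hterm : ∀ s : Finset (Fin m),
      |y (T (s.piecewise (fun j => (x j)⁺) fun j => -(x j)⁻))| ≤ 2 * D := fun s => by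
    have e : (s.piecewise (fun j => (x j)⁺) fun j => -(x j)⁻) =
        fun j => (if j ∈ s then (1 : ℝ) else -1) • if j ∈ s then (x j)⁺ else (x j)⁻ := by
      ext j
      by_cases hj : j ∈ s <;> simp [hj]
    have e1 : |∏ j : Fin m, if j ∈ s then (1 : ℝ) else -1| = 1 := by
      rw [Finset.abs_prod]
      exact Finset.prod_eq_one fun j _ => by split_ifs <;> simp
    rw [e, T.map_smul_univ, map_smul, smul_eq_mul, abs_mul, e1, one_mul]
    refine hy _ (fun j => ?_) fun j => ?_
    · split_ifs
      exacts [posPart_nonneg _, negPart_nonneg _]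
    · split_ifs
      exacts [(hpos _).1, (hpos _).2]
  have e : y (T x) = ∑ s : Finset (Fin m),
      y (T (s.piecewise (fun j => (x j)⁺) fun j => -(x j)⁻)) := by
    conv_lhs => rw [hx, T.map_add_univ, map_sum]
  rw [e]
  calc _ ≤ ∑ s : Finset (Fin m), |y (T (s.piecewise (fun j => (x j)⁺) fun j => -(x j)⁻))| :=
        Finset.abs_sum_le_sum_abs _ _
    _ ≤ ∑ _s : Finset (Fin m), 2 * D := Finset.sum_le_sum fun s _ => hterm s
    _ = _ := by
      rw [Finset.sum_const, Finset.card_univ, Fintype.card_finset, Fintype.card_fin, nsmul_eq_mul,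
        hD]
      push_cast
      ring

/-- The exponents `q_1, …, q_m, r` as one family. -/
def exponents (q : Fin m → ℝ≥0∞) (r : ℝ≥0∞) : Option (Fin m) → ℝ≥0∞ := fun k => k.elim r q

theorem one_le_exponents (hq : ∀ j, 1 ≤ q j) (hr : 1 ≤ r) (k : Option (Fin m)) :
    1 ≤ exponents q r k := by
  cases k
  exacts [hr, hq _]

theorem inv_eq_sum_exponents (h : p⁻¹ = (∑ j, (q j)⁻¹) + r⁻¹) :
    p⁻¹ = ∑ k, (exponents q r k)⁻¹ := by
  rw [Fintype.sum_option, add_comm]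
  exact h

theorem eq_top_of_inv_eq (hp : p = ∞) (h : p⁻¹ = (∑ j, (q j)⁻¹) + r⁻¹) :
    (∀ j, q j = ∞) ∧ r = ∞ := by
  rw [hp, ENNReal.inv_top, eq_comm, add_eq_zero] at h
  refine ⟨fun j => ?_, by simpa using h.2⟩
  have := Finset.sum_eq_zero_iff.1 h.1 j (Finset.mem_univ j)
  simpa using this

theorem le_mul_prod_mul_of_forall_pos {t C b : ℝ} {a : Fin m → ℝ}
    (h : ∀ ε : ℝ, 0 < ε → t ≤ C * ((∏ j, (a j + ε)) * (b + ε))) :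
    t ≤ C * ((∏ j, a j) * b) := by
  have := le_mul_prod_of_forall_pos (t := t) (C := C) (a := fun k : Option (Fin m) => k.elim b a)
    fun ε hε => by
      rw [Fintype.prod_option, mul_comm (_ + _)]
      exact h ε hε
  rw [Fintype.prod_option, mul_comm (Option.elim _ _ _)] at this
  exact this

theorem isPositiveDominated_of_forall_nonneg (hp : 1 ≤ p) (hq : ∀ j, 1 ≤ q j) (hr : 1 ≤ r)
    (hpqr : p⁻¹ = (∑ j, (q j)⁻¹) + r⁻¹)
    (T : ContinuousMultilinearMap ℝ E F) {C : ℝ} (hC : 0 < C)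
    (μ : ∀ j, Measure (posDualBall (E j))) (ν : Measure (posDualBall (StrongDual ℝ F)))
    [∀ j, IsProbabilityMeasure (μ j)] [IsProbabilityMeasure ν]
    (h : ∀ (x : ∀ j, E j) (y : StrongDual ℝ F), (∀ j, 0 ≤ x j) → 0 ≤ y →
      |y (T x)| ≤ C * domProd q r μ ν x y) : IsPositiveDominated p q r T := by
  refine ⟨C, hC, fun n x y hx hy => ?_⟩
  rw [mul_assoc]
  by_cases hp' : p = ∞
  · obtain ⟨hq', hr'⟩ := eq_top_of_inv_eq hp' hpqr
    subst hp' hr'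
    rw [seqNorm_top]
    have hnn : 0 ≤ (∏ j, weakSeqNorm (q j) (x j)) * weakSeqNorm ∞ y :=
      mul_nonneg (Finset.prod_nonneg fun j _ => weakSeqNorm_nonneg (hq j) _)
        (weakSeqNorm_nonneg hr _)
    refine Real.iSup_le (fun i => ?_) (mul_nonneg hC.le hnn)
    refine (h _ _ (fun j => hx j i) (hy i)).trans (mul_le_mul_of_nonneg_left ?_ hC.le)
    refine mul_le_mul (Finset.prod_le_prod (fun j _ => domFactor_nonneg _ _ (hx j i))
      fun j _ => ?_) (domFactor_top_le_weakSeqNorm ν y i) (domFactor_nonneg _ _ (hy i))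
      (Finset.prod_nonneg fun j _ => weakSeqNorm_nonneg (hq j) _)
    rw [hq' j]
    exact domFactor_top_le_weakSeqNorm (μ j) (x j) i
  have h0 : 0 < p.toReal := ENNReal.toReal_pos (zero_lt_one.trans_le hp).ne' hp'
  -- The Hölder inequality needs strictly positive bounds, but weak norms may vanish.
  refine le_mul_prod_mul_of_forall_pos fun ε hε => ?_
  have hW : ∀ j, 0 < weakSeqNorm (q j) (x j) + ε := fun j =>
    add_pos_of_nonneg_of_pos (weakSeqNorm_nonneg (hq j) _) hε
  have hW' : 0 < weakSeqNorm r y + ε := add_pos_of_nonneg_of_pos (weakSeqNorm_nonneg hr _) hε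
  set P := (∏ j, (weakSeqNorm (q j) (x j) + ε)) * (weakSeqNorm r y + ε) with hP
  have hP0 : 0 < P := mul_pos (Finset.prod_pos fun j _ => hW j) hW'
  have key : ∑ i, domProd q r μ ν (fun j => x j i) (y i) ^ p.toReal ≤ P ^ p.toReal := by
    have := sum_prod_rpow_le hp hp' (one_le_exponents hq hr) (inv_eq_sum_exponents hpqr)
      (d := fun k i => k.elim (domFactor r ν (y i)) fun j => domFactor (q j) (μ j) (x j i))
      (W := fun k => k.elim (weakSeqNorm r y + ε) fun j => weakSeqNorm (q j) (x j) + ε)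
      (fun k i => by
        cases k
        exacts [domFactor_nonneg _ _ (hy i), domFactor_nonneg _ _ (hx _ i)])
      (fun k => by
        cases k
        exacts [hW', hW _])
      (fun k hk => by
        cases k with
        | none =>
          exact (sum_domFactor_rpow_le hr hk ν hy).trans (Real.rpow_le_rpow
            (weakSeqNorm_nonneg hr _) (le_add_of_nonneg_right hε.le) ENNReal.toReal_nonneg)
        | some j =>
          exact (sum_domFactor_rpow_le (hq j) hk (μ j) (hx j)).trans (Real.rpow_le_rpow
            (weakSeqNorm_nonneg (hq j) _) (le_add_of_nonneg_right hε.le) ENNReal.toReal_nonneg))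
      (fun k hk i => by
        cases k with
        | none =>
          change r = ∞ at hk
          change domFactor r ν (y i) ≤ weakSeqNorm r y + ε
          rw [hk]
          exact (domFactor_top_le_weakSeqNorm ν y i).trans (le_add_of_nonneg_right hε.le)
        | some j =>
          change q j = ∞ at hk
          change domFactor (q j) (μ j) (x j i) ≤ weakSeqNorm (q j) (x j) + ε
          rw [hk]
          exact (domFactor_top_le_weakSeqNorm (μ j) (x j) i).trans
            (le_add_of_nonneg_right hε.le))
    simp only [Fintype.prod_option, Option.elim_none, Option.elim_some] at this
    simpa only [domProd, hP, mul_comm (Finset.prod _ _)] using this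
  rw [← Real.rpow_le_rpow_iff (seqNorm_nonneg hp _) (by positivity) h0, seqNorm_rpow hp hp',
    Real.mul_rpow hC.le hP0.le]
  refine le_trans ?_ (mul_le_mul_of_nonneg_left key (by positivity))
  rw [Finset.mul_sum]
  refine Finset.sum_le_sum fun i _ => ?_
  rw [← Real.mul_rpow hC.le (domProd_nonneg μ ν (fun j => hx j i) (hy i))]
  exact Real.rpow_le_rpow (abs_nonneg _) (h _ _ (fun j => hx j i) (hy i)) h0.le

end Dominated

/-! ### From domination to the measures. -/

section Domination

variable {m : ℕ} {p : ℝ≥0∞} {q : Fin m → ℝ≥0∞} {r : ℝ≥0∞}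
  {E : Fin m → Type*} [∀ j, NormedAddCommGroup (E j)] [∀ j, NormedSpace ℝ (E j)]
  [∀ j, Lattice (E j)]
  {F : Type*} [NormedAddCommGroup F] [NormedSpace ℝ F] [Lattice F] [HasSolidNorm F]
  [IsOrderedAddMonoid F]

theorem prod_mul_rpow_le (hp : 1 ≤ p) (hp' : p ≠ ∞) (hq : ∀ j, 1 ≤ q j) (hr : 1 ≤ r)
    (hpqr : p⁻¹ = (∑ j, (q j)⁻¹) + r⁻¹) {a : Fin m → ℝ} {b : ℝ} (ha : ∀ j, 0 ≤ a j) (hb : 0 ≤ b)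
    (ha1 : ∀ j, q j = ∞ → a j ≤ 1) (hb1 : r = ∞ → b ≤ 1) :
    ((∏ j, a j) * b) ^ p.toReal ≤ (∑ j, p.toReal / (q j).toReal * a j ^ (q j).toReal) +
      p.toReal / r.toReal * b ^ r.toReal := by
  have := prod_rpow_le_sum hp hp' (one_le_exponents hq hr) (inv_eq_sum_exponents hpqr)
    (b := fun k => k.elim b a)
    (fun k => by
      cases k
      exacts [hb, ha _])
    (fun k hk => by
      cases k
      exacts [hb1 hk, ha1 _ hk])
  rw [Fintype.prod_option, Fintype.sum_option, mul_comm (Option.elim _ _ _), add_comm] at this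
  exact this

theorem sum_toReal_div_add (hp : 1 ≤ p) (hp' : p ≠ ∞) (hq : ∀ j, 1 ≤ q j) (hr : 1 ≤ r)
    (hpqr : p⁻¹ = (∑ j, (q j)⁻¹) + r⁻¹) :
    (∑ j, p.toReal / (q j).toReal) + p.toReal / r.toReal = 1 := by
  have := sum_toReal_div hp hp' (one_le_exponents hq hr) (inv_eq_sum_exponents hpqr)
  rw [Fintype.sum_option, add_comm] at this
  exact this

theorem prod_rpow_inv_mul_rpow (hp : 1 ≤ p) (hp' : p ≠ ∞) (hq : ∀ j, 1 ≤ q j) (hr : 1 ≤ r)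
    (hpqr : p⁻¹ = (∑ j, (q j)⁻¹) + r⁻¹) {c : ℝ} (hc : 0 ≤ c) :
    ((∏ j, c ^ (q j).toReal⁻¹) * c ^ r.toReal⁻¹) ^ p.toReal = c := by
  have := prod_rpow_inv_rpow hp hp' (one_le_exponents hq hr) (inv_eq_sum_exponents hpqr) hc
  rw [Fintype.prod_option, mul_comm] at this
  exact this

/-- The positive tuples that are normalised in the coordinates with exponent `∞`. -/
def normalizedTuples (q : Fin m → ℝ≥0∞) (r : ℝ≥0∞) (E : Fin m → Type*)
    [∀ j, NormedAddCommGroup (E j)] [∀ j, NormedSpace ℝ (E j)] [∀ j, Lattice (E j)]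
    (F : Type*) [NormedAddCommGroup F] [NormedSpace ℝ F] [Lattice F] [HasSolidNorm F]
    [IsOrderedAddMonoid F] : Set ((∀ j, E j) × StrongDual ℝ F) :=
  {z | (∀ j, 0 ≤ z.1 j) ∧ 0 ≤ z.2 ∧ (∀ j, q j = ∞ → domFactor ∞ 0 (z.1 j) ≤ 1) ∧
    (r = ∞ → domFactor ∞ 0 z.2 ≤ 1)}

theorem exists_weakSeqNorm_mul_le {s : ℝ≥0∞} (hs : 1 ≤ s) {G : Type*} [NormedAddCommGroup G]
    [NormedSpace ℝ G] [Lattice G] [HasSolidNorm G] [IsOrderedAddMonoid G] {n : ℕ} {x : Fin n → G}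
    (hx : ∀ i, 0 ≤ x i) (c : ℝ) (hc : 0 ≤ c) : ∃ φ : posDualBall G,
      c / s.toReal * weakSeqNorm s x ^ s.toReal ≤
        c / s.toReal * ∑ i, (φ.1 (x i)) ^ s.toReal := by
  by_cases h : s = ∞
  · obtain ⟨φ⟩ := (inferInstance : Nonempty (posDualBall G))
    exact ⟨φ, by simp [h]⟩
  · obtain ⟨φ, hφ⟩ := exists_weakSeqNorm_rpow_le hs h hx
    exact ⟨φ, mul_le_mul_of_nonneg_left hφ (by positivity)⟩

theorem exists_sum_rpow_le [∀ j, HasSolidNorm (E j)] [∀ j, IsOrderedAddMonoid (E j)]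
    (hp : 1 ≤ p) (hp' : p ≠ ∞) (hq : ∀ j, 1 ≤ q j) (hr : 1 ≤ r)
    (hpqr : p⁻¹ = (∑ j, (q j)⁻¹) + r⁻¹) {T : ContinuousMultilinearMap ℝ E F} {C : ℝ} (hC : 0 < C)
    (hT : ∀ (n : ℕ) (x : ∀ j, Fin n → E j) (y : Fin n → StrongDual ℝ F),
      (∀ j i, 0 ≤ x j i) → (∀ i, 0 ≤ y i) →
        seqNorm p (fun i => y i (T fun j => x j i)) ≤
          C * (∏ j, weakSeqNorm (q j) (x j)) * weakSeqNorm r y)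
    {n : ℕ} {x : ∀ j, Fin n → E j} {y : Fin n → StrongDual ℝ F}
    (hxy : ∀ i, (fun j => x j i, y i) ∈ normalizedTuples q r E F) :
    ∃ (φ : ∀ j, posDualBall (E j)) (ψ : posDualBall (StrongDual ℝ F)),
      ∑ i, |y i (T fun j => x j i)| ^ p.toReal ≤ C ^ p.toReal *
        ((∑ j, p.toReal / (q j).toReal * ∑ i, ((φ j).1 (x j i)) ^ (q j).toReal) +
          p.toReal / r.toReal * ∑ i, (ψ.1 (y i)) ^ r.toReal) := by
  have hx : ∀ j i, 0 ≤ x j i := fun j i => (hxy i).1 j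
  have hy : ∀ i, 0 ≤ y i := fun i => (hxy i).2.1
  choose φ hφ using fun j => exists_weakSeqNorm_mul_le (hq j) (hx j) p.toReal
    ENNReal.toReal_nonneg
  obtain ⟨ψ, hψ⟩ := exists_weakSeqNorm_mul_le hr hy p.toReal ENNReal.toReal_nonneg
  refine ⟨φ, ψ, ?_⟩
  have hP : 0 ≤ (∏ j, weakSeqNorm (q j) (x j)) * weakSeqNorm r y :=
    mul_nonneg (Finset.prod_nonneg fun j _ => weakSeqNorm_nonneg (hq j) _)
      (weakSeqNorm_nonneg hr _)
  rw [← seqNorm_rpow hp hp']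
  have h1 := hT n x y hx hy
  rw [mul_assoc] at h1
  refine (Real.rpow_le_rpow (seqNorm_nonneg hp _) h1 ENNReal.toReal_nonneg).trans ?_
  rw [Real.mul_rpow hC.le hP]
  refine mul_le_mul_of_nonneg_left ?_ (by positivity)
  refine (prod_mul_rpow_le hp hp' hq hr hpqr (fun j => weakSeqNorm_nonneg (hq j) _)
    (weakSeqNorm_nonneg hr _) (fun j hj => ?_) fun hr' => ?_).trans
    (add_le_add (Finset.sum_le_sum fun j _ => hφ j) hψ)
  · rw [hj]
    exact weakSeqNorm_top_le (hx j) 0 zero_le_one fun i => (hxy i).2.2.1 j hj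
  · rw [hr']
    exact weakSeqNorm_top_le hy 0 zero_le_one fun i => (hxy i).2.2.2 hr'

theorem toReal_div_mul_rpow_smul (c : ℝ) {s : ℝ≥0∞} (hs : 1 ≤ s) {G : Type*}
    [NormedAddCommGroup G] [NormedSpace ℝ G] [PartialOrder G] (φ : posDualBall G) {x : G}
    (hx : 0 ≤ x) {w : ℝ} (hw : 0 ≤ w) :
    c / s.toReal * (φ.1 (w ^ s.toReal⁻¹ • x)) ^ s.toReal =
      w * (c / s.toReal * (φ.1 x) ^ s.toReal) := by
  by_cases h : s = ∞
  · simp [h]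
  · have h0 : s.toReal ≠ 0 := (ENNReal.toReal_pos (zero_lt_one.trans_le hs).ne' h).ne'
    rw [map_smul, smul_eq_mul, Real.mul_rpow (by positivity) (posDualBall_apply_nonneg φ hx),
      Real.rpow_inv_rpow hw h0]
    ring

/-- For an infinite exponent the scaling factor is w^0 = 1, so the normalisation survives. -/
theorem smul_mem_normalizedTuples [∀ j, IsOrderedModule ℝ (E j)]
    {z : (∀ j, E j) × StrongDual ℝ F} (hz : z ∈ normalizedTuples q r E F) {w : ℝ} (hw : 0 ≤ w) :
    ((fun j => w ^ (q j).toReal⁻¹ • z.1 j, w ^ r.toReal⁻¹ • z.2) :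
      (∀ j, E j) × StrongDual ℝ F) ∈ normalizedTuples q r E F := by
  refine ⟨fun j => smul_nonneg (Real.rpow_nonneg hw _) (hz.1 j), fun v hv =>
    mul_nonneg (Real.rpow_nonneg hw _) (dual_nonneg_iff.1 hz.2.1 v hv), fun j hj => ?_,
    fun hr => ?_⟩
  · simpa [hj] using hz.2.2.1 j hj
  · simpa [hr] using hz.2.2.2 hr

theorem exists_weighted_sum_nonpos [∀ j, HasSolidNorm (E j)] [∀ j, IsOrderedAddMonoid (E j)]
    [∀ j, IsOrderedModule ℝ (E j)]
    (hp : 1 ≤ p) (hp' : p ≠ ∞) (hq : ∀ j, 1 ≤ q j) (hr : 1 ≤ r)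
    (hpqr : p⁻¹ = (∑ j, (q j)⁻¹) + r⁻¹) {T : ContinuousMultilinearMap ℝ E F} {C : ℝ} (hC : 0 < C)
    (hT : ∀ (n : ℕ) (x : ∀ j, Fin n → E j) (y : Fin n → StrongDual ℝ F),
      (∀ j i, 0 ≤ x j i) → (∀ i, 0 ≤ y i) →
        seqNorm p (fun i => y i (T fun j => x j i)) ≤
          C * (∏ j, weakSeqNorm (q j) (x j)) * weakSeqNorm r y)
    {n : ℕ} {w : Fin n → ℝ} (hw : ∀ i, 0 ≤ w i) {z : Fin n → (∀ j, E j) × StrongDual ℝ F}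
    (hz : ∀ i, z i ∈ normalizedTuples q r E F) :
    ∃ (φ : ∀ j, posDualBall (E j)) (ψ : posDualBall (StrongDual ℝ F)),
      ∑ i, w i * (|(z i).2 (T (z i).1)| ^ p.toReal - C ^ p.toReal *
        ((∑ j, p.toReal / (q j).toReal * ((φ j).1 ((z i).1 j)) ^ (q j).toReal) +
          p.toReal / r.toReal * (ψ.1 (z i).2) ^ r.toReal)) ≤ 0 := by
  obtain ⟨φ, ψ, h⟩ := exists_sum_rpow_le hp hp' hq hr hpqr hC hT
    (x := fun j i => w i ^ (q j).toReal⁻¹ • (z i).1 j) (y := fun i => w i ^ r.toReal⁻¹ • (z i).2)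
    fun i => smul_mem_normalizedTuples (hz i) (hw i)
  refine ⟨φ, ψ, ?_⟩
  -- The exponents 1/p_j and 1/r add up to 1/p, so multilinearity and the power p return exactly the
  -- weight w_i.
  have e : ∀ i, |(w i ^ r.toReal⁻¹ • (z i).2) (T fun j => w i ^ (q j).toReal⁻¹ • (z i).1 j)| ^
      p.toReal = w i * |(z i).2 (T (z i).1)| ^ p.toReal := fun i => by
    have h0 : 0 ≤ (∏ j, w i ^ (q j).toReal⁻¹) * w i ^ r.toReal⁻¹ :=
      mul_nonneg (Finset.prod_nonneg fun j _ => Real.rpow_nonneg (hw i) _)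
        (Real.rpow_nonneg (hw i) _)
    rw [T.map_smul_univ, smul_apply, map_smul, smul_eq_mul, smul_eq_mul, ← mul_assoc,
      mul_comm (w i ^ r.toReal⁻¹), abs_mul, abs_of_nonneg h0, Real.mul_rpow h0 (abs_nonneg _),
      prod_rpow_inv_mul_rpow hp hp' hq hr hpqr (hw i)]
  simp_rw [e, Finset.mul_sum, toReal_div_mul_rpow_smul _ (hq _) _ ((hz _).1 _) (hw _),
    toReal_div_mul_rpow_smul _ hr _ (hz _).2.1 (hw _)] at h
  rw [Finset.sum_comm, ← Finset.sum_add_distrib, Finset.mul_sum] at h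
  rw [← sub_nonpos, ← Finset.sum_sub_distrib] at h
  refine le_of_eq_of_le (Finset.sum_congr rfl fun i _ => ?_) h
  rw [← Finset.mul_sum]
  ring

/-- The continuous function `φ ↦ φ(x)^s` on the positive part of the dual ball. -/
noncomputable def evalRpow {G : Type*} [NormedAddCommGroup G] [NormedSpace ℝ G] [PartialOrder G]
    (s : ℝ≥0∞) (x : G) : C(posDualBall G, ℝ) :=
  ⟨fun φ => (φ.1 x) ^ s.toReal, continuous_posDualBall_rpow x ENNReal.toReal_nonneg⟩

theorem exists_measures_rpow_le [∀ j, HasSolidNorm (E j)] [∀ j, IsOrderedAddMonoid (E j)]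
    [∀ j, IsOrderedModule ℝ (E j)]
    (hp : 1 ≤ p) (hp' : p ≠ ∞) (hq : ∀ j, 1 ≤ q j) (hr : 1 ≤ r)
    (hpqr : p⁻¹ = (∑ j, (q j)⁻¹) + r⁻¹) {T : ContinuousMultilinearMap ℝ E F} {C : ℝ} (hC : 0 < C)
    (hT : ∀ (n : ℕ) (x : ∀ j, Fin n → E j) (y : Fin n → StrongDual ℝ F),
      (∀ j i, 0 ≤ x j i) → (∀ i, 0 ≤ y i) →
        seqNorm p (fun i => y i (T fun j => x j i)) ≤
          C * (∏ j, weakSeqNorm (q j) (x j)) * weakSeqNorm r y) :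
    ∃ (μ : ∀ j, Measure (posDualBall (E j))) (ν : Measure (posDualBall (StrongDual ℝ F))),
      (∀ j, IsProbabilityMeasure (μ j)) ∧ IsProbabilityMeasure ν ∧
      ∀ z ∈ normalizedTuples q r E F, |z.2 (T z.1)| ^ p.toReal ≤ C ^ p.toReal *
        ((∑ j, p.toReal / (q j).toReal * domFactor (q j) (μ j) (z.1 j) ^ (q j).toReal) +
          p.toReal / r.toReal * domFactor r ν z.2 ^ r.toReal) := by
  let π : ∀ j, C((∀ j, posDualBall (E j)) × posDualBall (StrongDual ℝ F), posDualBall (E j)) :=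
    fun j => ⟨fun ω => ω.1 j, by fun_prop⟩
  let π' : C((∀ j, posDualBall (E j)) × posDualBall (StrongDual ℝ F),
      posDualBall (StrongDual ℝ F)) := ⟨Prod.snd, by fun_prop⟩
  let f : normalizedTuples q r E F →
      C((∀ j, posDualBall (E j)) × posDualBall (StrongDual ℝ F), ℝ) := fun z =>
    |z.1.2 (T z.1.1)| ^ p.toReal • 1 - C ^ p.toReal •
      ((∑ j, (p.toReal / (q j).toReal) • (evalRpow (q j) (z.1.1 j)).comp (π j)) +
        (p.toReal / r.toReal) • (evalRpow r z.1.2).comp π')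
  have : Nonempty (normalizedTuples q r E F) :=
    ⟨⟨0, fun j => le_rfl, le_rfl, fun j _ => by simp [domFactor_top],
      fun _ => by simp [domFactor_top]⟩⟩
  obtain ⟨Λ, hΛ, h1, hf⟩ := exists_positive_functional f fun n w z hw => by
    obtain ⟨φ, ψ, h⟩ := exists_weighted_sum_nonpos hp hp' hq hr hpqr hC hT hw
      (z := fun i => (z i).1) fun i => (z i).2
    refine ⟨(φ, ψ), ?_⟩
    simpa [f, evalRpow, π, π', mul_add] using h
  choose μ hμ hμΛ using fun j => exists_marginal_measure Λ hΛ h1 (π j)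
  obtain ⟨ν, hν, hνΛ⟩ := exists_marginal_measure Λ hΛ h1 π'
  refine ⟨μ, ν, hμ, hν, fun z hz => ?_⟩
  have e : ∀ j, p.toReal / (q j).toReal * domFactor (q j) (μ j) (z.1 j) ^ (q j).toReal =
      p.toReal / (q j).toReal * ∫ φ, evalRpow (q j) (z.1 j) φ ∂(μ j) := fun j => by
    by_cases h : q j = ∞
    · simp [h]
    · rw [domFactor_rpow (hq j) h (μ j) (hz.1 j)]
      rfl
  have e' : p.toReal / r.toReal * domFactor r ν z.2 ^ r.toReal =
      p.toReal / r.toReal * ∫ φ, evalRpow r z.2 φ ∂ν := by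
    by_cases h : r = ∞
    · simp [h]
    · rw [domFactor_rpow hr h ν hz.2.1]
      rfl
  have h2 := hf ⟨z, hz⟩
  simp only [f, map_sub, map_smul, map_add, map_sum, h1, smul_eq_mul, mul_one, ← hμΛ,
    ← hνΛ, sub_nonpos] at h2
  rw [e']
  simp_rw [e]
  exact h2

theorem exists_measures_of_isPositiveDominated [∀ j, HasSolidNorm (E j)]
    [∀ j, IsOrderedAddMonoid (E j)] [∀ j, IsOrderedModule ℝ (E j)]
    (hp : 1 ≤ p) (hq : ∀ j, 1 ≤ q j) (hr : 1 ≤ r)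
    (hpqr : p⁻¹ = (∑ j, (q j)⁻¹) + r⁻¹) {T : ContinuousMultilinearMap ℝ E F}
    (hT : IsPositiveDominated p q r T) :
    ∃ C : ℝ, 0 < C ∧ ∃ (μ : ∀ j, Measure (posDualBall (E j)))
      (ν : Measure (posDualBall (StrongDual ℝ F))),
      (∀ j, IsProbabilityMeasure (μ j)) ∧ IsProbabilityMeasure ν ∧
      ∀ (x : ∀ j, E j) (y : StrongDual ℝ F), (∀ j, 0 ≤ x j) → 0 ≤ y →
        |y (T x)| ≤ C * domProd q r μ ν x y := by
  obtain ⟨C, hC, hT⟩ := hT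
  refine ⟨C, hC, ?_⟩
  by_cases hp' : p = ∞
  · obtain ⟨hq', hr'⟩ := eq_top_of_inv_eq hp' hpqr
    subst hp' hr'
    obtain ⟨φ⟩ := (inferInstance : Nonempty (∀ j, posDualBall (E j)))
    obtain ⟨ψ⟩ := (inferInstance : Nonempty (posDualBall (StrongDual ℝ F)))
    -- With all exponents infinite the factors ignore the measures, so any probability measures
    -- serve, and domination is needed only for n = 1.
    refine ⟨fun j => Measure.dirac (φ j), Measure.dirac ψ, fun j => inferInstance, inferInstance,
      fun x y hx hy => ?_⟩
    have h := hT 1 (fun j _ => x j) (fun _ => y) (fun j _ => hx j) fun _ => hy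
    rw [seqNorm_top, ciSup_const, mul_assoc] at h
    refine h.trans (mul_le_mul_of_nonneg_left ?_ hC.le)
    refine mul_le_mul (Finset.prod_le_prod (fun j _ => weakSeqNorm_nonneg (hq j) _)
      fun j _ => ?_) ?_ (weakSeqNorm_nonneg hr _)
      (Finset.prod_nonneg fun j _ => domFactor_nonneg _ _ (hx j))
    · rw [hq' j]
      exact weakSeqNorm_top_le (fun _ => hx j) _ (domFactor_nonneg _ _ (hx j)) fun _ => le_rfl
    · exact weakSeqNorm_top_le (fun _ => hy) _ (domFactor_nonneg _ _ hy) fun _ => le_rfl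
  have h0 : 0 < p.toReal := ENNReal.toReal_pos (zero_lt_one.trans_le hp).ne' hp'
  obtain ⟨μ, ν, hμ, hν, h⟩ := exists_measures_rpow_le hp hp' hq hr hpqr hC hT
  refine ⟨μ, ν, hμ, hν, fun x y hx hy => le_mul_prod_mul_of_forall_pos fun ε hε => ?_⟩
  have ha : ∀ j, 0 < domFactor (q j) (μ j) (x j) + ε := fun j =>
    add_pos_of_nonneg_of_pos (domFactor_nonneg _ _ (hx j)) hε
  have hb : 0 < domFactor r ν y + ε := add_pos_of_nonneg_of_pos (domFactor_nonneg _ _ hy) hε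
  -- Dividing by these numbers makes every factor at most 1, so the weighted sum is at most the sum
  -- of the weights, which is 1. Homogeneity then restores the product.
  set a := fun j => domFactor (q j) (μ j) (x j) + ε with ha_def
  set b := domFactor r ν y + ε with hb_def
  have hax : ∀ j, 0 ≤ (a j)⁻¹ • x j := fun j => smul_nonneg (inv_nonneg.2 (ha j).le) (hx j)
  have hby : 0 ≤ b⁻¹ • y := fun v hv => mul_nonneg (inv_nonneg.2 hb.le) (hy v hv)
  have hda : ∀ j, domFactor (q j) (μ j) ((a j)⁻¹ • x j) ≤ 1 := fun j => by
    rw [domFactor_smul _ _ (inv_nonneg.2 (ha j).le) (hq j) (hx j), inv_mul_le_one₀ (ha j)]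
    exact le_add_of_nonneg_right hε.le
  have hdb : domFactor r ν (b⁻¹ • y) ≤ 1 := by
    rw [domFactor_smul _ _ (inv_nonneg.2 hb.le) hr hy, inv_mul_le_one₀ hb]
    exact le_add_of_nonneg_right hε.le
  have hP : 0 < (∏ j, a j) * b := mul_pos (Finset.prod_pos fun j _ => ha j) hb
  have h1 := h (fun j => (a j)⁻¹ • x j, b⁻¹ • y) ⟨hax, hby, fun j hj => by
    have := hda j
    rwa [hj, domFactor_top] at this, fun hr' => by
    rwa [hr', domFactor_top] at hdb⟩
  have h2 : |(b⁻¹ • y) (T fun j => (a j)⁻¹ • x j)| ^ p.toReal ≤ C ^ p.toReal := by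
    refine h1.trans (mul_le_of_le_one_right (by positivity) ?_)
    rw [← sum_toReal_div_add hp hp' hq hr hpqr]
    refine add_le_add (Finset.sum_le_sum fun j _ => ?_) ?_
    · exact mul_le_of_le_one_right (by positivity)
        (Real.rpow_le_one (domFactor_nonneg _ _ (hax j)) (hda j) ENNReal.toReal_nonneg)
    · exact mul_le_of_le_one_right (by positivity)
        (Real.rpow_le_one (domFactor_nonneg _ _ hby) hdb ENNReal.toReal_nonneg)
  rw [Real.rpow_le_rpow_iff (abs_nonneg _) hC.le h0, T.map_smul_univ, smul_apply, map_smul,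
    smul_eq_mul, smul_eq_mul, ← mul_assoc, Finset.prod_inv_distrib, mul_comm b⁻¹, ← mul_inv,
    abs_mul, abs_of_pos (inv_pos.2 hP), inv_mul_le_iff₀ hP, mul_comm _ C] at h2
  exact h2

end Domination

end PositiveDominated

theorem mainTheorem2 {m : ℕ} (p : ℝ≥0∞) (q : Fin m → ℝ≥0∞) (r : ℝ≥0∞)
    (hp : 1 ≤ p) (hq : ∀ j, 1 ≤ q j) (hr : 1 ≤ r) (hpqr : p⁻¹ = (∑ j, (q j)⁻¹) + r⁻¹)
    {E : Fin m → Type*} [∀ j, NormedAddCommGroup (E j)] [∀ j, NormedSpace ℝ (E j)]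
    [∀ j, Lattice (E j)] [∀ j, HasSolidNorm (E j)] [∀ j, IsOrderedAddMonoid (E j)]
    [∀ j, IsOrderedModule ℝ (E j)] [∀ j, CompleteSpace (E j)]
    {F : Type*} [NormedAddCommGroup F] [NormedSpace ℝ F] [Lattice F] [HasSolidNorm F]
    [IsOrderedAddMonoid F] [IsOrderedModule ℝ F] [CompleteSpace F]
    (T : ContinuousMultilinearMap ℝ E F) :
    List.TFAE [
      PositiveDominated.IsPositiveDominated p q r T,
      ∃ C : ℝ, 0 < C ∧ ∃ (μ : ∀ j, Measure (PositiveDominated.posDualBall (E j)))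
          (ν : Measure (PositiveDominated.posDualBall (StrongDual ℝ F))),
        (∀ j, IsProbabilityMeasure (μ j)) ∧ IsProbabilityMeasure ν ∧
        ∀ (x : ∀ j, E j) (y : StrongDual ℝ F),
          |y (T x)| ≤ C * (∏ j, PositiveDominated.domFactor (q j) (μ j) |x j|) *
            PositiveDominated.domFactor r ν |y|,
      ∃ C : ℝ, 0 < C ∧ ∃ (μ : ∀ j, Measure (PositiveDominated.posDualBall (E j)))
          (ν : Measure (PositiveDominated.posDualBall (StrongDual ℝ F))),
        (∀ j, IsProbabilityMeasure (μ j)) ∧ IsProbabilityMeasure ν ∧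
        ∀ (x : ∀ j, E j) (y : StrongDual ℝ F), (∀ j, 0 ≤ x j) → 0 ≤ y →
          |y (T x)| ≤ C * (∏ j, PositiveDominated.domFactor (q j) (μ j) (x j)) *
            PositiveDominated.domFactor r ν y] := by
  tfae_have 1 → 3 := fun h => by
    obtain ⟨C, hC, μ, ν, hμ, hν, h⟩ :=
      PositiveDominated.exists_measures_of_isPositiveDominated hp hq hr hpqr h
    exact ⟨C, hC, μ, ν, hμ, hν, fun x y hx hy => by
      rw [mul_assoc]
      exact h x y hx hy⟩
  tfae_have 3 → 1 := by
    rintro ⟨C, hC, μ, ν, hμ, hν, h⟩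
    exact PositiveDominated.isPositiveDominated_of_forall_nonneg hp hq hr hpqr T hC μ ν
      fun x y hx hy => by
        have := h x y hx hy
        rwa [mul_assoc] at this
  tfae_have 3 → 2 := by
    rintro ⟨C, hC, μ, ν, hμ, hν, h⟩
    refine ⟨2 ^ (m + 1) * C, by positivity, μ, ν, hμ, hν, fun x y => ?_⟩
    rw [mul_assoc _ (Finset.prod _ _)]
    exact PositiveDominated.abs_apply_le_of_forall_nonneg T hC μ ν (fun x y hx hy => by
      have := h x y hx hy
      rwa [mul_assoc] at this) x y
  tfae_have 2 → 3 := by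
    rintro ⟨C, hC, μ, ν, hμ, hν, h⟩
    refine ⟨C, hC, μ, ν, hμ, hν, fun x y hx hy => ?_⟩
    have := h x y
    rw [abs_of_nonneg hy] at this
    simp_rw [abs_of_nonneg (hx _)] at this
    exact this
  tfae_finish
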